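/- **Setting.** Let $G=(V,E)$ be a finite directed graph, let $A=\bigsqcup_{v\in V}A_v$ with each $A_v$ finite, and let $Q=\prod_{v\in V}Q_v$ with each $Q_v$ finite. An abelian network $\mathcal N$ on $G$ has at each vertex $v$ an abelian processor: commuting transition maps $t_a:Q_v\to Q_v$ $(a\in A_v)$ and message functions $o_a^u:Q_v\to A_u^*$ $(a\in A_v,\ (v,u)\in E)$ such that, from any state, input words that are equal up to permutation produce on each edge $(v,u)$ output words that are equal up to permutation. Let $M_v$ be the monoid of self-maps of $Q_v$ generated by the $t_a$, $a\in A_v$. The network is *irreducible* if for every $v$ and all $q,q'\in Q_v$ there are $m,m'\in M_v$ with $mq=m'q'$. **Executions.** A total state $\mathbf x.\mathbf q$ consists of $\mathbf x\in\mathbb Z^A$ (letters waiting) and $\mathbf q\in Q$. Processing a letter $a\in A_v$ decreases $\mathbf x_a$ by one, adds the letters of the words $o_a^u(\mathbf q_v)$ to $\mathbf x$, and replaces $\mathbf q_v$ by $t_a(\mathbf q_v)$. A word $w\in A^*$ is *legal* for $\mathbf x.\mathbf q$ if each of its letters is present (count at least $1$) when it is processed, and *complete* if after executing $w$ all letter counts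 are $\le 0$. The network *halts on all inputs* if every $\mathbf x.\mathbf q$ with $\mathbf x\in\mathbb N^A$, $\mathbf q\in Q$ has a complete legal execution; the *odometer* $[\mathbf x.\mathbf q]\in\mathbb N^A$ then counts the occurrences of each letter in any complete legal execution. **Production matrix.** Let $e_v$ be the minimal idempotent of $M_v$ (the unique idempotent $e$ with $e\in M_vm$ for all $m\in M_v$). A state $\mathbf q$ is *locally recurrent* if $\mathbf q_v\in e_vQ_v$ for all $v$. The maps $t_a$ permute $e_vQ_v$, so $\mathbb Z^{A_v}$ acts on $e_vQ_v$; let $K_v$ be the kernel of this action and $K=\prod_vK_v\subset\mathbb Z^A$. For $\mathbf k\in K\cap\mathbb N^A$ and $\mathbf q$ locally recurrent, processing exactly the letters $\mathbf k$ (each $a$ being processed $\mathbf k_a$ times) from $\mathbf k.\mathbf q$ results in $P_{\mathbf q}(\mathbf k).\mathbf q$ with $P_{\mathbf q}(\mathbf k)\in\mathbb N^A$. The *production matrix* $P$ is the rational $A\times A$ matrix whose column at $a$ is $\frac1{r_a}P_{\mathbf q}(r_a\mathbf 1_a)$, where $r_a=\min\{m\ge1: m\mathbf 1_a\in K\}$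 and $\mathbf q$ is a locally recurrent state. **Theorem.** Let $\mathcal N$ be a finite irreducible abelian network that halts on all inputs. Then $P\mathbf k=P_{\mathbf q}(\mathbf k)$ for all $\mathbf k\in K\cap\mathbb N^A$ and all locally recurrent $\mathbf q$, the matrix $I-P$ is invertible, and there is a constant $C$ depending only on $\mathcal N$ such that for all $\mathbf x\in\mathbb N^A$ and all $\mathbf q\in Q$, $$\big\|[\mathbf x.\mathbf q]-(I-P)^{-1}\mathbf x\big\|_\infty\le C .$$ Consequently the production matrix determines the running time up to an additive constant: there is a constant $C'$ depending only on $\mathcal N$ such that for all $\mathbf x\in\mathbb N^A$, $\mathbf q\in Q$ and every complete legal execution $w$ for $\mathbf x.\mathbf q$, the length of $w$ differs from $\mathbf 1^T(I-P)^{-1}\mathbf x$ by at most $C'$. -/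

import Mathlib

open Matrix

/-- A finite word in which every letter `a` occurs exactly `x a` times. -/
noncomputable def wordOf {I : Type*} [Fintype I] (x : I → ℕ) : List I :=
  (Finset.univ : Finset I).toList.flatMap fun a => List.replicate (x a) a

/-- `e` is the minimal idempotent of the monoid `M` of self-maps of `X`: the idempotent of `M` that
is accessible from every element of `M` (it is unique when `M` is commutative, and it exists when
`M` is moreover finite). -/
def IsMinimalIdempotent {X : Type*} (M : Submonoid (Function.End X)) (e : Function.End X) : Prop :=
  e ∈ M ∧ e * e = e ∧ ∀ m ∈ M, ∃ m' ∈ M, e = m' * m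

/-- The action of a monoid `M` of self-maps of `X` is irreducible: any two points `x, x'` satisfy
`m x = m' x'` for some `m, m' ∈ M`. -/
def IsIrreducibleAction {X : Type*} (M : Submonoid (Function.End X)) : Prop :=
  ∀ x x' : X, ∃ m ∈ M, ∃ m' ∈ M, m x = m' x'

/-- The state reached from `q` by reading a word from left to right. -/
def runWord {I Q : Type*} (t : I → Q → Q) : List I → Q → Q
  | [], q => q
  | a :: w, q => runWord t w (t a q)

/-- The word emitted while reading a word from left to right, starting in state `q`. -/
def outputWord {I Q B : Type*} (t : I → Q → Q) (o : I → Q → List B) : List I → Q → List B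
  | [], _ => []
  | a :: w, q => o a q ++ outputWord t o w (t a q)

/-- An abelian processor with input alphabet `I`, state space `Q` and output alphabets
`(B u)_{u : U}`: commuting transition maps `t a`, and message passing functions `o a u`, such that
input words equal up to permutation yield, on every feed `u` and from every state, output words
equal up to permutation. -/
structure AbelianProcessor (I Q : Type*) {U : Type*} (B : U → Type*) where
  t : I → Q → Q
  o : I → (u : U) → Q → List (B u)
  t_comm : ∀ (a b : I) (q : Q), t a (t b q) = t b (t a q)
  o_perm : ∀ (w w' : List I), w.Perm w' → ∀ (u : U) (q : Q),
    (outputWord t (fun a => o a u) w q).Perm (outputWord t (fun a => o a u) w' q)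

namespace AbelianProcessor

variable {I Q U : Type*} {B : U → Type*}

/-- The transition monoid, generated by the transition maps. -/
def transitionMonoid (p : AbelianProcessor I Q B) : Submonoid (Function.End Q) :=
  Submonoid.closure (Set.range fun a : I => (p.t a : Function.End Q))

/-- A processor is irreducible if its transition monoid acts irreducibly on its state space. -/
def IsIrreducible (p : AbelianProcessor I Q B) : Prop :=
  IsIrreducibleAction p.transitionMonoid

/-- The set `e Q`, where `e` is the minimal idempotent of the transition monoid. -/
def recurrentStates (p : AbelianProcessor I Q B) : Set Q :=
  {q | ∃ e : Function.End Q, IsMinimalIdempotent p.transitionMonoid e ∧ ∃ q' : Q, q = e q'}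

/-- The action `∏ a, (t a) ^ (x a)` of a vector `x` of natural numbers on the states. -/
noncomputable def act [Fintype I] (p : AbelianProcessor I Q B) (x : I → ℕ) (q : Q) : Q :=
  runWord p.t (wordOf x) q

/-- The kernel of the action of `ℤ ^ I` on `e Q`. As each `t a` permutes `e Q`, the integer vector
`k` with positive and negative parts `k⁺`, `k⁻` acts there as `t(k⁺) ∘ t(k⁻)⁻¹`, and it acts
trivially iff `t(k⁺)` and `t(k⁻)` agree on `e Q`. -/
def kernel [Fintype I] (p : AbelianProcessor I Q B) : Set (I → ℤ) :=
  {k | ∀ q ∈ p.recurrentStates,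
    p.act (fun a => (k a).toNat) q = p.act (fun a => (-k a).toNat) q}

end AbelianProcessor

/-- An abelian network on the directed graph `G`, with alphabet `⨆ v, A v` and state space
`∏ v, Q v`: an abelian processor at each vertex `v`, whose input alphabet is `A v` and whose output
alphabets are the `A u` for the out-neighbours `u` of `v`. -/
structure AbelianNetwork {V : Type*} (G : Digraph V) (A Q : V → Type*) where
  proc : (v : V) →
    AbelianProcessor (A v) (Q v) (U := {u : V // G.Adj v u}) (fun u => A u.1)

namespace AbelianNetwork

variable {V : Type*} {G : Digraph V} {A Q : V → Type*}

/-- Irreducibility of the network: every processor is irreducible. -/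
def IsIrreducible (N : AbelianNetwork G A Q) : Prop :=
  ∀ v, (N.proc v).IsIrreducible

/-- Locally recurrent states of the network. -/
def IsLocallyRecurrent (N : AbelianNetwork G A Q) (q : ∀ v, Q v) : Prop :=
  ∀ v, q v ∈ (N.proc v).recurrentStates

section Executions

variable [DecidableEq V] [∀ v, DecidableEq (A v)]

open scoped Classical in
/-- The number of letters `c` sent out when the letter `a` is processed in state `q`. -/
noncomputable def message (N : AbelianNetwork G A Q) (a : Σ v, A v) (q : ∀ v, Q v)
    (c : Σ v, A v) : ℕ :=
  if h : G.Adj a.1 c.1 then ((N.proc a.1).o a.2 ⟨c.1, h⟩ (q a.1)).count c.2 else 0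

/-- Processing one letter `a` in the total state `x.q`: one letter `a` is removed (a debt is
recorded if there is none), messages are sent, the processor owning `a` changes state. -/
noncomputable def step (N : AbelianNetwork G A Q) (a : Σ v, A v)
    (s : ((Σ v, A v) → ℤ) × (∀ v, Q v)) : ((Σ v, A v) → ℤ) × (∀ v, Q v) :=
  (fun c => s.1 c - (if c = a then 1 else 0) + N.message a s.2 c,
    Function.update s.2 a.1 ((N.proc a.1).t a.2 (s.2 a.1)))

/-- Executing a word from left to right. -/
noncomputable def exec (N : AbelianNetwork G A Q) :
    List (Σ v, A v) → ((Σ v, A v) → ℤ) × (∀ v, Q v) → ((Σ v, A v) → ℤ) × (∀ v, Q v)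
  | [], s => s
  | a :: w, s => N.exec w (N.step a s)

/-- An execution is legal if each letter it processes is present when it is processed. -/
def IsLegal (N : AbelianNetwork G A Q) :
    List (Σ v, A v) → ((Σ v, A v) → ℤ) × (∀ v, Q v) → Prop
  | [], _ => True
  | a :: w, s => 1 ≤ s.1 a ∧ N.IsLegal w (N.step a s)

/-- An execution is complete if it leaves no letters to be processed. -/
def IsComplete (N : AbelianNetwork G A Q) (w : List (Σ v, A v))
    (s : ((Σ v, A v) → ℤ) × (∀ v, Q v)) : Prop :=
  ∀ a, (N.exec w s).1 a ≤ 0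

/-- The total state `x.q` for a vector `x` of natural numbers. -/
def input (x : (Σ v, A v) → ℕ) (q : ∀ v, Q v) : ((Σ v, A v) → ℤ) × (∀ v, Q v) :=
  (fun a => (x a : ℤ), q)

/-- `w` is a complete legal execution for `x.q`. -/
def IsCompleteLegal (N : AbelianNetwork G A Q) (w : List (Σ v, A v))
    (x : (Σ v, A v) → ℕ) (q : ∀ v, Q v) : Prop :=
  N.IsLegal w (input x q) ∧ N.IsComplete w (input x q)

/-- The network halts on all inputs: every `x.q` has a complete legal execution. -/
def HaltsOnAllInputs (N : AbelianNetwork G A Q) : Prop :=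
  ∀ (x : (Σ v, A v) → ℕ) (q : ∀ v, Q v), ∃ w, N.IsCompleteLegal w x q

open scoped Classical in
/-- The odometer `[x.q]`: the letter counts of a complete legal execution for `x.q` (the choice does
not matter, see `AbelianNetwork.odometer_eq`). -/
noncomputable def odometer (N : AbelianNetwork G A Q) (x : (Σ v, A v) → ℕ) (q : ∀ v, Q v) :
    (Σ v, A v) → ℕ :=
  if h : ∃ w, N.IsCompleteLegal w x q then fun a => h.choose.count a else 0

theorem step_comm (N : AbelianNetwork G A Q) (a b : Σ v, A v)
    (s : ((Σ v, A v) → ℤ) × (∀ v, Q v)) : N.step a (N.step b s) = N.step b (N.step a s) := by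
  obtain ⟨x, q⟩ := s
  obtain ⟨v, a⟩ := a
  obtain ⟨u, b⟩ := b
  by_cases huv : v = u
  · subst huv
    refine Prod.ext ?_ ?_
    · funext c
      simp only [step, message, Function.update_self]
      split_ifs with h <;> try omega
      all_goals
        have := ((N.proc v).o_perm [a, b] [b, a] (List.Perm.swap b a []) ⟨c.1, ‹_›⟩ (q v)).count_eq
          c.2
        simp only [outputWord, List.append_nil, List.count_append] at this
        omega
    · simp [step, (N.proc v).t_comm a b]
  · refine Prod.ext ?_ ?_
    · funext c
      simp only [step, message, Function.update_of_ne huv, Function.update_of_ne (Ne.symm huv)]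
      omega
    · simp only [step, Function.update_of_ne huv, Function.update_of_ne (Ne.symm huv)]
      exact Function.update_comm (Ne.symm huv) _ _ _

/-- The result of an execution depends on the word only up to permutation. -/
theorem exec_perm (N : AbelianNetwork G A Q) {w w' : List (Σ v, A v)} (h : w.Perm w')
    (s : ((Σ v, A v) → ℤ) × (∀ v, Q v)) : N.exec w s = N.exec w' s := by
  induction h generalizing s with
  | nil => rfl
  | cons a _ ih => exact ih _
  | swap a b l => simp only [exec, N.step_comm a b s]
  | trans _ _ ih₁ ih₂ => rw [ih₁, ih₂]

theorem le_exec_of_notMem (N : AbelianNetwork G A Q) {a : Σ v, A v} {w : List (Σ v, A v)}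
    (h : a ∉ w) (s : ((Σ v, A v) → ℤ) × (∀ v, Q v)) : s.1 a ≤ (N.exec w s).1 a := by
  induction w generalizing s with
  | nil => exact le_rfl
  | cons b w ih =>
    simp only [List.mem_cons, not_or] at h
    refine le_trans ?_ (ih h.2 (N.step b s))
    simp [step, h.1]

/-- Least action principle. -/
theorem count_le_of_isLegal_of_isComplete (N : AbelianNetwork G A Q) {w w' : List (Σ v, A v)}
    {s : ((Σ v, A v) → ℤ) × (∀ v, Q v)} (hw : N.IsLegal w s) (hw' : N.IsComplete w' s)
    (c : Σ v, A v) : w.count c ≤ w'.count c := by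
  induction w generalizing w' s with
  | nil => simp
  | cons a w ih =>
    have ha : a ∈ w' := by
      by_contra h
      have h₁ := N.le_exec_of_notMem h s
      have h₂ := hw' a
      have h₃ := hw.1
      omega
    have hp := List.perm_cons_erase ha
    have hc : N.IsComplete (w'.erase a) (N.step a s) := fun b => by
      have := hw' b
      rwa [N.exec_perm hp] at this
    rw [hp.count_eq, List.count_cons, List.count_cons]
    exact Nat.add_le_add_right (ih hw.2 hc) _

/-- The odometer may be computed from any complete legal execution. -/
theorem odometer_eq (N : AbelianNetwork G A Q) {x : (Σ v, A v) → ℕ} {q : ∀ v, Q v}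
    {w : List (Σ v, A v)} (hw : N.IsCompleteLegal w x q) (a : Σ v, A v) :
    N.odometer x q a = w.count a := by
  have h : ∃ w, N.IsCompleteLegal w x q := ⟨w, hw⟩
  simp only [odometer, dif_pos h]
  exact le_antisymm (N.count_le_of_isLegal_of_isComplete h.choose_spec.1 hw.2 a)
    (N.count_le_of_isLegal_of_isComplete hw.1 h.choose_spec.2 a)

end Executions

section Production

variable [Fintype V] [DecidableEq V] [∀ v, Fintype (A v)] [∀ v, DecidableEq (A v)]

/-- The local action `x ▷ q = π_x(x.q)`: exactly the letters of `x` are processed. -/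
noncomputable def localAct (N : AbelianNetwork G A Q) (x : (Σ v, A v) → ℕ) (q : ∀ v, Q v) :
    ((Σ v, A v) → ℤ) × (∀ v, Q v) :=
  N.exec (wordOf x) (input x q)

/-- The total kernel `K = ∏ v, K v`. -/
def totalKernel (N : AbelianNetwork G A Q) : Set ((Σ v, A v) → ℤ) :=
  {k | ∀ v, (fun b : A v => k ⟨v, b⟩) ∈ (N.proc v).kernel}

/-- The reset number `r_a`, the least `m ≥ 1` such that `m` times the unit vector at `a` lies in the
total kernel. -/
noncomputable def resetNumber (N : AbelianNetwork G A Q) (a : Σ v, A v) : ℕ :=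
  sInf {m : ℕ | 1 ≤ m ∧ (Pi.single a (m : ℤ) : (Σ v, A v) → ℤ) ∈ N.totalKernel}

open scoped Classical in
/-- The production matrix: the matrix of the linear map `P` on `ℚ ^ (⨆ v, A v)` whose value at the
unit vector of `a` is `(1 / r) P_q(r 1_a)` with `r = r_a`, where `P_q(k)` is defined for nonnegative
`k` in the total kernel and for a locally recurrent state `q` by `k ▷ q = P_q(k).q`. -/
noncomputable def productionMatrix (N : AbelianNetwork G A Q) :
    Matrix (Σ v, A v) (Σ v, A v) ℚ :=
  if h : ∃ q, N.IsLocallyRecurrent q then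
    Matrix.of fun b a =>
      ((N.localAct (Pi.single a (N.resetNumber a)) h.choose).1 b : ℚ) / (N.resetNumber a : ℚ)
  else 0

/-- `P` is the matrix of the production map: `k ▷ q = P(k).q` for every nonnegative `k` in the total
kernel and every locally recurrent state `q`. -/
def RepresentsProduction (N : AbelianNetwork G A Q) (P : Matrix (Σ v, A v) (Σ v, A v) ℚ) : Prop :=
  ∀ k : (Σ v, A v) → ℕ, (fun a => (k a : ℤ)) ∈ N.totalKernel →
    ∀ q, N.IsLocallyRecurrent q →
      (∀ b, ((N.localAct k q).1 b : ℚ) = (P *ᵥ fun a => (k a : ℚ)) b) ∧ (N.localAct k q).2 = q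

end Production

end AbelianNetwork

/-! Compare the letters sent out while processing `x` from `q` with the prediction `P x`. Their
difference is additive along concatenated inputs and depends only on `x` and `q`, not on the order
of processing. It vanishes for `x ∈ K ∩ ℕ ^ A` and `q` locally recurrent, so from locally recurrent
states it depends only on `x` modulo the resets `r_a 1_a` and is therefore bounded; a fixed input
making every state locally recurrent extends the bound to all states. For a complete legal execution
conservation of letters reads `(I - P) [x.q] = x + O(1)`. Thus the image of `I - P` comes within
bounded distance of every point of `ℕ ^ A`, which forces `I - P` to be invertible, and applying the
inverse gives `[x.q] = (I - P)⁻¹ x + O(1)`. -/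

section Words

variable {I : Type*} [Fintype I]

theorem count_wordOf [DecidableEq I] (x : I → ℕ) (a : I) : (wordOf x).count a = x a := by
  simp only [wordOf, List.count_flatMap, Function.comp_def, List.count_replicate, beq_iff_eq]
  rw [Finset.sum_map_toList, Finset.sum_ite_eq' Finset.univ a x, if_pos (Finset.mem_univ a)]

theorem perm_wordOf_count [DecidableEq I] (w : List I) : w.Perm (wordOf fun a => w.count a) :=
  List.perm_iff_count.2 fun a => (count_wordOf (fun b => w.count b) a).symm

theorem wordOf_add_perm (x y : I → ℕ) : (wordOf (x + y)).Perm (wordOf x ++ wordOf y) := by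
  classical exact List.perm_iff_count.2 fun a => by simp [count_wordOf]

theorem wordOf_zero : wordOf (0 : I → ℕ) = [] := by
  simp [wordOf, List.flatMap_eq_nil_iff]

theorem sum_count_eq_length [DecidableEq I] (w : List I) : ∑ a, w.count a = w.length := by
  simpa only [Multiset.coe_count, Multiset.coe_card] using
    Multiset.sum_count_eq_card (m := (w : Multiset I)) fun a _ => Finset.mem_univ a

end Words

section RunWord

variable {I Q : Type*} {t : I → Q → Q}

theorem runWord_append (w w' : List I) (q : Q) :
    runWord t (w ++ w') q = runWord t w' (runWord t w q) := by
  induction w generalizing q with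
  | nil => rfl
  | cons a _ ih => exact ih _

theorem runWord_perm (ht : ∀ a b q, t a (t b q) = t b (t a q)) {w w' : List I}
    (h : w.Perm w') (q : Q) : runWord t w q = runWord t w' q := by
  induction h generalizing q with
  | nil => rfl
  | cons a _ ih => exact ih _
  | swap a b l => simp only [runWord, ht]
  | trans _ _ ih₁ ih₂ => rw [ih₁, ih₂]

end RunWord

section FiniteMonoid

theorem exists_pow_isIdempotentElem {M : Type*} [Monoid M] [Finite M] (m : M) :
    ∃ n, 0 < n ∧ IsIdempotentElem (m ^ n) := by
  let _ : TopologicalSpace M := ⊥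
  have : DiscreteTopology M := ⟨rfl⟩
  obtain ⟨_, ⟨n, hn, rfl⟩, h⟩ := exists_idempotent_in_compact_subsemigroup
    (fun _ => continuous_of_discreteTopology) ((m ^ ·) '' Set.Ioi 0) ⟨m ^ 1, 1, one_pos, rfl⟩
    (Set.toFinite _).isCompact (by
      rintro _ ⟨i, hi, rfl⟩ _ ⟨j, hj, rfl⟩
      exact ⟨i + j, Set.mem_Ioi.2 (add_pos hi hj), pow_add m i j⟩)
  exact ⟨n, hn, h⟩

/-- A suitable power of the product of all elements is idempotent. -/
theorem exists_isIdempotentElem_forall_dvd (M : Type*) [CommMonoid M] [Finite M] :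
    ∃ e : M, IsIdempotentElem e ∧ ∀ m, m ∣ e := by
  have := Fintype.ofFinite M
  obtain ⟨n, hn, h⟩ := exists_pow_isIdempotentElem (∏ m : M, m)
  exact ⟨_, h, fun m => (Finset.dvd_prod_of_mem id (Finset.mem_univ m)).trans
    (dvd_pow_self _ hn.ne')⟩

theorem exists_isMinimalIdempotent {X : Type*} [Finite X] {M : Submonoid (Function.End X)}
    (hM : ∀ m ∈ M, ∀ m' ∈ M, m * m' = m' * m) : ∃ e, IsMinimalIdempotent M e := by
  have : Finite (Function.End X) := inferInstanceAs (Finite (X → X))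
  let _ : CommMonoid M :=
    { mul_comm := fun m m' => Subtype.ext (hM m m.2 m' m'.2) }
  obtain ⟨e, he, hdvd⟩ := exists_isIdempotentElem_forall_dvd M
  refine ⟨e, e.2, congrArg Subtype.val he, fun m hm => ?_⟩
  obtain ⟨m', h⟩ := hdvd ⟨m, hm⟩
  exact ⟨m', m'.2, congrArg Subtype.val (h.trans (mul_comm _ _))⟩

end FiniteMonoid

namespace AbelianProcessor

variable {I Q U : Type*} {B : U → Type*} [Fintype I] {p : AbelianProcessor I Q B}

@[simp]
theorem act_zero (q : Q) : p.act 0 q = q := by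
  simp only [act, wordOf_zero, runWord]

theorem act_add (x y : I → ℕ) (q : Q) : p.act (x + y) q = p.act y (p.act x q) :=
  (runWord_perm p.t_comm (wordOf_add_perm x y) q).trans (runWord_append _ _ q)

theorem act_count [DecidableEq I] (w : List I) (q : Q) :
    p.act (fun a => w.count a) q = runWord p.t w q :=
  (runWord_perm p.t_comm (perm_wordOf_count w) q).symm

theorem act_single [DecidableEq I] (a : I) (n : ℕ) :
    p.act (Pi.single a n) = (p.t a)^[n] := by
  have h₁ (q : Q) : p.act (Pi.single a 1) q = p.t a q := by
    refine Eq.trans (congrArg (p.act · q) ?_) (p.act_count [a] q)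
    ext b
    obtain rfl | h := eq_or_ne b a
    · simp
    · simp [h, h.symm]
  induction n with
  | zero => ext q; simp
  | succ n ih =>
    ext q
    rw [Pi.single_add, act_add, h₁, ih, Function.iterate_succ_apply']

theorem mem_transitionMonoid_iff {m : Function.End Q} :
    m ∈ p.transitionMonoid ↔ ∃ x, p.act x = m := by
  classical
  constructor
  · intro hm
    induction hm using Submonoid.closure_induction with
    | mem m hm =>
      obtain ⟨a, rfl⟩ := hm
      exact ⟨Pi.single a 1, act_single a 1⟩
    | one => exact ⟨0, funext act_zero⟩
    | mul m m' _ _ hm hm' =>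
      obtain ⟨x, rfl⟩ := hm
      obtain ⟨y, rfl⟩ := hm'
      exact ⟨y + x, funext (act_add y x)⟩
  · rintro ⟨x, rfl⟩
    have hrun (w : List I) : (runWord p.t w : Function.End Q) ∈ p.transitionMonoid := by
      induction w with
      | nil => exact p.transitionMonoid.one_mem
      | cons a w ih =>
        exact p.transitionMonoid.mul_mem ih (Submonoid.subset_closure (Set.mem_range_self a))
    exact hrun (wordOf x)

variable (p) in
theorem exists_forall_act_mem_recurrentStates [Finite Q] :
    ∃ x, ∀ q, p.act x q ∈ p.recurrentStates := by
  obtain ⟨e, he⟩ : ∃ e, IsMinimalIdempotent p.transitionMonoid e := by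
    refine exists_isMinimalIdempotent fun m hm m' hm' => ?_
    obtain ⟨x, rfl⟩ := mem_transitionMonoid_iff.1 hm
    obtain ⟨y, rfl⟩ := mem_transitionMonoid_iff.1 hm'
    funext q
    exact (act_add y x q).symm.trans ((congrArg (p.act · q) (add_comm y x)).trans (act_add x y q))
  obtain ⟨x, rfl⟩ := mem_transitionMonoid_iff.1 he.1
  exact ⟨x, fun q => ⟨_, he, q, rfl⟩⟩

theorem exists_act_act_eq {q : Q} (hq : q ∈ p.recurrentStates) (x : I → ℕ) :
    ∃ y, p.act y (p.act x q) = q := by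
  obtain ⟨e, ⟨-, hidem, hmin⟩, q', rfl⟩ := hq
  obtain ⟨m, hm, h⟩ := hmin (p.act x) (mem_transitionMonoid_iff.2 ⟨x, rfl⟩)
  obtain ⟨y, rfl⟩ := mem_transitionMonoid_iff.1 hm
  exact ⟨y, (congrFun h (e q')).symm.trans (congrFun hidem q')⟩

theorem act_eq_self_of_act_act {x : I → ℕ} (hx : ∀ q, p.act x (p.act x q) = p.act x q) {q : Q}
    (hq : q ∈ p.recurrentStates) : p.act x q = q := by
  obtain ⟨y, hy⟩ := exists_act_act_eq hq x
  calc p.act x q = p.act x (p.act y (p.act x q)) := by rw [hy]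
    _ = p.act y (p.act x (p.act x q)) := by rw [← act_add, ← act_add x y, add_comm]
    _ = q := by rw [hx, hy]

variable (p) in
theorem exists_act_single_eq_self [DecidableEq I] [Finite Q] (a : I) :
    ∃ n, 0 < n ∧ ∀ q ∈ p.recurrentStates, p.act (Pi.single a n) q = q := by
  have : Finite (Function.End Q) := inferInstanceAs (Finite (Q → Q))
  obtain ⟨n, hn, h⟩ := exists_pow_isIdempotentElem (M := Function.End Q) (p.t a)
  exact ⟨n, hn, fun q hq => act_eq_self_of_act_act (by rw [act_single]; exact congrFun h) hq⟩

theorem IsIrreducible.exists_act_eq (hp : p.IsIrreducible) (q : Q) {q' : Q}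
    (hq' : q' ∈ p.recurrentStates) : ∃ x, p.act x q = q' := by
  obtain ⟨m, hm, m', hm', h⟩ := hp q q'
  obtain ⟨x, rfl⟩ := mem_transitionMonoid_iff.1 hm
  obtain ⟨y, rfl⟩ := mem_transitionMonoid_iff.1 hm'
  obtain ⟨z, hz⟩ := exists_act_act_eq hq' y
  exact ⟨x + z, by rw [act_add, h, hz]⟩

theorem natCast_mem_kernel_iff {k : I → ℕ} :
    (fun a => (k a : ℤ)) ∈ p.kernel ↔ ∀ q ∈ p.recurrentStates, p.act k q = q := by
  simp only [kernel, Set.mem_ofPred_eq, Int.toNat_natCast, Int.toNat_neg_natCast]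
  exact forall₂_congr fun q _ => by rw [show (fun _ : I => 0) = 0 from rfl, act_zero]

end AbelianProcessor

section Lattice

variable {ι : Type*} [DecidableEq ι]

theorem natCast_single {R : Type*} [AddMonoidWithOne R] (a : ι) (n : ℕ) :
    (fun b => ((Pi.single a n : ι → ℕ) b : R)) = Pi.single a (n : R) := by
  ext b
  obtain rfl | hba := eq_or_ne b a
  · simp only [Pi.single_eq_same]
  · simp only [Pi.single_eq_of_ne hba, Nat.cast_zero]

theorem mul_eq_sum_nsmul_single [Fintype ι] (r c : ι → ℕ) :
    r * c = ∑ a, c a • Pi.single a (r a) := by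
  ext b
  simp [Finset.sum_apply, Pi.single_apply, mul_comm]

variable [Finite ι] {S : AddSubmonoid (ι → ℕ)} {r : ι → ℕ}

theorem mul_mem_of_single_mem (hS : ∀ a, Pi.single a (r a) ∈ S) (c : ι → ℕ) : r * c ∈ S := by
  have := Fintype.ofFinite ι
  rw [mul_eq_sum_nsmul_single]
  exact sum_mem fun a _ => nsmul_mem (hS a) (c a)

theorem addMonoidHom_eq_of_single_mem {E : Type*} [AddCommMonoid E] [IsAddTorsionFree E]
    (hr : ∀ a, r a ≠ 0) (hS : ∀ a, Pi.single a (r a) ∈ S) {f g : S →+ E}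
    (h : ∀ a, f ⟨_, hS a⟩ = g ⟨_, hS a⟩) : f = g := by
  have := Fintype.ofFinite ι
  ext k
  let R := ∏ a, r a
  have hR : R ≠ 0 := Finset.prod_ne_zero_iff.2 fun a _ => hr a
  obtain ⟨c, hc⟩ : ∃ c : ι → ℕ, R • k = ∑ a, c a • (⟨_, hS a⟩ : S) := by
    refine ⟨fun a => R / r a * (k : ι → ℕ) a, Subtype.ext ?_⟩
    push_cast
    rw [← mul_eq_sum_nsmul_single]
    ext a
    change R * (k : ι → ℕ) a = r a * (R / r a * (k : ι → ℕ) a)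
    rw [← mul_assoc, Nat.mul_div_cancel' (Finset.dvd_prod_of_mem r (Finset.mem_univ a))]
  refine nsmul_right_injective hR ?_
  simp only [← map_nsmul, hc]
  simp only [map_sum, map_nsmul, h]

end Lattice

section Matrix

variable {ι : Type*} [Fintype ι] [DecidableEq ι]

/-- A row vector `y` annihilated by `M` satisfies `n * y a = y ⬝ᵥ (n 1_a - M *ᵥ z)` for all `z`, so
it vanishes if the right-hand side stays bounded as `n` grows. -/
theorem isUnit_of_forall_exists_norm_mulVec_sub_le {𝕜 : Type*} [NormedField 𝕜]
    [NormSMulClass ℤ 𝕜] {M : Matrix ι ι 𝕜} {C : ℝ}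
    (h : ∀ x : ι → ℕ, ∃ z, ‖M *ᵥ z - fun a => (x a : 𝕜)‖ ≤ C) : IsUnit M := by
  rw [isUnit_iff_isUnit_det, isUnit_iff_ne_zero]
  intro hdet
  obtain ⟨y, hy, hyM⟩ := exists_vecMul_eq_zero_iff.2 hdet
  obtain ⟨a, ha⟩ := Function.ne_iff.1 hy
  obtain ⟨n, hn⟩ := exists_lt_nsmul (norm_pos_iff.2 ha) (∑ b, ‖y b‖ * C)
  obtain ⟨z, hz⟩ := h (Pi.single a n)
  set d := M *ᵥ z - fun b => ((Pi.single a n : ι → ℕ) b : 𝕜) with hd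
  have hyd : y ⬝ᵥ d = -(n • y a) := by
    rw [hd, natCast_single, dotProduct_sub, dotProduct_mulVec, hyM, zero_dotProduct,
      dotProduct_single, zero_sub, nsmul_eq_mul, mul_comm]
  refine hn.not_ge ?_
  calc n • ‖y a‖ = ‖y ⬝ᵥ d‖ := by
        rw [hyd, norm_neg, nsmul_eq_mul, nsmul_eq_mul, norm_mul, norm_natCast]
    _ ≤ ∑ b, ‖y b * d b‖ := norm_sum_le _ _
    _ ≤ ∑ b, ‖y b‖ * C := Finset.sum_le_sum fun b _ => by
        rw [norm_mul]
        exact mul_le_mul_of_nonneg_left ((norm_le_pi_norm d b).trans hz) (norm_nonneg _)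

theorem norm_length_sub_sum_le {𝕜 : Type*} [SeminormedRing 𝕜] (w : List ι) (y : ι → 𝕜) :
    ‖(w.length : 𝕜) - ∑ a, y a‖ ≤ Fintype.card ι • ‖(fun a => (w.count a : 𝕜)) - y‖ := by
  have hsum : (w.length : 𝕜) - ∑ a, y a = ∑ a, ((w.count a : 𝕜) - y a) := by
    rw [Finset.sum_sub_distrib, ← Nat.cast_sum, sum_count_eq_length]
  rw [hsum]
  exact (norm_sum_le _ _).trans (Pi.sum_norm_apply_le_norm _)

end Matrix

namespace AbelianNetwork

variable {V : Type*} {G : Digraph V} {A Q : V → Type*} {N : AbelianNetwork G A Q}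

section TotalKernel

variable [∀ v, Fintype (A v)]

theorem natCast_mem_totalKernel_iff {k : (Σ v, A v) → ℕ} :
    (fun a => (k a : ℤ)) ∈ N.totalKernel ↔
      ∀ v, ∀ q ∈ (N.proc v).recurrentStates, (N.proc v).act (fun b => k ⟨v, b⟩) q = q :=
  forall_congr' fun _ => AbelianProcessor.natCast_mem_kernel_iff

variable (N) in
/-- The submonoid `K ∩ ℕ ^ A` of the nonnegative vectors in the total kernel. -/
def natKernel : AddSubmonoid ((Σ v, A v) → ℕ) where
  carrier := {k | (fun a => (k a : ℤ)) ∈ N.totalKernel}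
  zero_mem' := natCast_mem_totalKernel_iff.2 fun _ q _ => AbelianProcessor.act_zero q
  add_mem' {k l} hk hl := natCast_mem_totalKernel_iff.2 fun v q hq =>
    (AbelianProcessor.act_add (fun b => k ⟨v, b⟩) (fun b => l ⟨v, b⟩) q).trans <| by
      rw [natCast_mem_totalKernel_iff.1 hk v q hq, natCast_mem_totalKernel_iff.1 hl v q hq]

variable [DecidableEq V] [∀ v, DecidableEq (A v)] [∀ v, Finite (Q v)]

variable (N) in
theorem exists_single_mem_natKernel (a : Σ v, A v) :
    ∃ n, 0 < n ∧ Pi.single a n ∈ N.natKernel := by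
  obtain ⟨u, a⟩ := a
  obtain ⟨n, hn, h⟩ := (N.proc u).exists_act_single_eq_self a
  refine ⟨n, hn, natCast_mem_totalKernel_iff.2 fun v q hq => ?_⟩
  obtain rfl | huv := eq_or_ne u v
  · have hsingle : (fun b => (Pi.single (⟨u, a⟩ : Σ v, A v) n : (Σ v, A v) → ℕ) ⟨u, b⟩)
        = Pi.single a n := by
      ext b
      simp [Pi.single_apply]
    rw [hsingle, h q hq]
  · have hzero : (fun b => (Pi.single (⟨u, a⟩ : Σ v, A v) n : (Σ v, A v) → ℕ) ⟨v, b⟩) = 0 := by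
      ext b
      simp [huv.symm]
    rw [hzero, AbelianProcessor.act_zero]

variable (N) in
theorem resetNumber_spec (a : Σ v, A v) :
    0 < N.resetNumber a ∧ Pi.single a (N.resetNumber a) ∈ N.natKernel := by
  have hset : {m : ℕ | 1 ≤ m ∧ (Pi.single a (m : ℤ) : (Σ v, A v) → ℤ) ∈ N.totalKernel}
      = {m | 0 < m ∧ Pi.single a m ∈ N.natKernel} := by
    simp only [← natCast_single]
    rfl
  rw [resetNumber, hset]
  exact Nat.sInf_mem (N.exists_single_mem_natKernel a)

end TotalKernel

variable [DecidableEq V] [∀ v, DecidableEq (A v)]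

section LocalAction

theorem exec_append (w w' : List (Σ v, A v)) (s : ((Σ v, A v) → ℤ) × (∀ v, Q v)) :
    N.exec (w ++ w') s = N.exec w' (N.exec w s) := by
  induction w generalizing s with
  | nil => rfl
  | cons a _ ih => exact ih (N.step a s)

theorem exec_add (w : List (Σ v, A v)) (y z : (Σ v, A v) → ℤ) (q : ∀ v, Q v) :
    N.exec w (y + z, q) = (y + (N.exec w (z, q)).1, (N.exec w (z, q)).2) := by
  induction w generalizing z q with
  | nil => rfl
  | cons a w ih =>
    have hstep : N.step a (y + z, q) = (y + (N.step a (z, q)).1, (N.step a (z, q)).2) :=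
      Prod.ext (funext fun c => by simp only [step, Pi.add_apply]; ring) rfl
    rw [exec, hstep, ih]
    rfl

theorem IsLegal.exec_nonneg {w : List (Σ v, A v)} {s : ((Σ v, A v) → ℤ) × (∀ v, Q v)}
    (h : N.IsLegal w s) (hs : 0 ≤ s.1) : 0 ≤ (N.exec w s).1 := by
  induction w generalizing s with
  | nil => exact hs
  | cons a w ih =>
    refine ih h.2 fun c => ?_
    have ha := h.1
    have hc : 0 ≤ s.1 c := hs c
    simp only [step, Pi.zero_apply]
    split_ifs with hca
    · subst hca
      omega
    · omega

variable [∀ v, Fintype (A v)]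

theorem exec_snd_apply (w : List (Σ v, A v)) (s : ((Σ v, A v) → ℤ) × (∀ v, Q v)) (v : V) :
    (N.exec w s).2 v = (N.proc v).act (fun b => w.count ⟨v, b⟩) (s.2 v) := by
  induction w generalizing s with
  | nil => exact (AbelianProcessor.act_zero _).symm
  | cons a w ih =>
    obtain ⟨u, a⟩ := a
    rw [exec, ih]
    obtain rfl | huv := eq_or_ne u v
    · have hcount : (fun b => (⟨u, a⟩ :: w).count (⟨u, b⟩ : Σ v, A v))
          = Pi.single a 1 + fun b => w.count ⟨u, b⟩ := by
        funext b
        obtain rfl | hab := eq_or_ne a b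
        · simp [add_comm]
        · simp [hab, hab.symm]
      rw [hcount, AbelianProcessor.act_add, AbelianProcessor.act_single]
      simp [step]
    · simp [step, huv, huv.symm]

variable [Fintype V]

theorem exec_eq_localAct (w : List (Σ v, A v)) (s : ((Σ v, A v) → ℤ) × (∀ v, Q v)) :
    N.exec w s = ((fun a => s.1 a - w.count a) + (N.localAct (fun a => w.count a) s.2).1,
      (N.localAct (fun a => w.count a) s.2).2) := by
  rw [localAct, ← N.exec_perm (perm_wordOf_count w), input, ← exec_add]
  have hsplit : (fun a => s.1 a - (w.count a : ℤ)) + (fun a => (w.count a : ℤ)) = s.1 :=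
    funext fun a => sub_add_cancel _ _
  rw [hsplit]

theorem localAct_add (x y : (Σ v, A v) → ℕ) (q : ∀ v, Q v) :
    N.localAct (x + y) q = ((N.localAct x q).1 + (N.localAct y (N.localAct x q).2).1,
      (N.localAct y (N.localAct x q).2).2) := by
  have hinput : input (x + y) q = ((input y q).1 + (input x q).1, q) :=
    Prod.ext (funext fun a => by simp [input, add_comm]) rfl
  have hx : N.exec (wordOf x) (input (x + y) q)
      = ((N.localAct x q).1 + (input y q).1, (N.localAct x q).2) := by
    rw [hinput, exec_add, add_comm]
    rfl
  rw [localAct, N.exec_perm (wordOf_add_perm x y), exec_append, hx, exec_add]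
  rfl

variable (N) in
theorem localAct_add_comm (x y : (Σ v, A v) → ℕ) (q : ∀ v, Q v) :
    (N.localAct x q).1 + (N.localAct y (N.localAct x q).2).1
      = (N.localAct y q).1 + (N.localAct x (N.localAct y q).2).1 := by
  have h := congrArg (fun z => (N.localAct z q).1) (add_comm x y)
  simpa only [localAct_add] using h

theorem localAct_snd_apply (x : (Σ v, A v) → ℕ) (q : ∀ v, Q v) (v : V) :
    (N.localAct x q).2 v = (N.proc v).act (fun b => x ⟨v, b⟩) (q v) := by
  simp only [localAct, exec_snd_apply, count_wordOf, input]

theorem localAct_zero (q : ∀ v, Q v) : N.localAct 0 q = (0, q) := by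
  rw [localAct, wordOf_zero]
  rfl

variable (N) in
theorem exists_forall_isLocallyRecurrent_localAct [∀ v, Finite (Q v)] :
    ∃ x, ∀ q, N.IsLocallyRecurrent (N.localAct x q).2 := by
  choose x hx using fun v => (N.proc v).exists_forall_act_mem_recurrentStates
  exact ⟨fun a => x a.1 a.2, fun q v => by
    rw [localAct_snd_apply]
    exact hx v (q v)⟩

theorem IsIrreducible.exists_localAct_snd_eq (hN : N.IsIrreducible) (q : ∀ v, Q v)
    {q' : ∀ v, Q v} (hq' : N.IsLocallyRecurrent q') : ∃ x, (N.localAct x q).2 = q' := by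
  choose x hx using fun v => (hN v).exists_act_eq (q v) (hq' v)
  exact ⟨fun a => x a.1 a.2, funext fun v => by rw [localAct_snd_apply, hx]⟩

end LocalAction

section Production

variable [Fintype V] [∀ v, Fintype (A v)]

theorem localAct_snd_eq_self {k : (Σ v, A v) → ℕ} (hk : k ∈ N.natKernel) {q : ∀ v, Q v}
    (hq : N.IsLocallyRecurrent q) : (N.localAct k q).2 = q :=
  funext fun v => by
    rw [localAct_snd_apply, natCast_mem_totalKernel_iff.1 hk v (q v) (hq v)]

/-- The production map `P_q` on `K ∩ ℕ ^ A`, for a locally recurrent state `q`: processing exactly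
the letters `k` from `k.q` results in `P_q(k).q`. -/
noncomputable def production {q : ∀ v, Q v} (hq : N.IsLocallyRecurrent q) :
    N.natKernel →+ (Σ v, A v) → ℚ where
  toFun k b := (N.localAct k q).1 b
  map_zero' := by
    ext b
    simp [localAct_zero]
  map_add' k l := by
    ext b
    simp [localAct_add, localAct_snd_eq_self k.2 hq]

/-- Reach `q'` from `q` by some input `x`; processing `k` before or after `x` emits the same
letters. -/
theorem IsIrreducible.production_eq (hN : N.IsIrreducible) {q q' : ∀ v, Q v}
    (hq : N.IsLocallyRecurrent q) (hq' : N.IsLocallyRecurrent q') :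
    production hq = production hq' := by
  ext k b
  obtain ⟨x, rfl⟩ := hN.exists_localAct_snd_eq q hq'
  have h := congrFun (N.localAct_add_comm k x q) b
  rw [localAct_snd_eq_self k.2 hq, add_comm, Pi.add_apply, Pi.add_apply] at h
  exact congrArg Int.cast (add_left_cancel h)

variable [∀ v, Finite (Q v)]

theorem IsIrreducible.productionMatrix_mulVec_single (hN : N.IsIrreducible) {q : ∀ v, Q v}
    (hq : N.IsLocallyRecurrent q) (a : Σ v, A v) :
    N.productionMatrix *ᵥ Pi.single a (N.resetNumber a : ℚ)
      = production hq ⟨_, (N.resetNumber_spec a).2⟩ := by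
  have hex : ∃ q, N.IsLocallyRecurrent q := ⟨q, hq⟩
  have hr : (N.resetNumber a : ℚ) ≠ 0 := Nat.cast_ne_zero.2 (N.resetNumber_spec a).1.ne'
  rw [hN.production_eq hq hex.choose_spec, productionMatrix, dif_pos hex]
  ext b
  simp [production, hr]

/-- Some multiple of every vector in `K ∩ ℕ ^ A` is a sum of resets `r_a 1_a`, and the matrix is
defined so as to have the right values on these. -/
theorem IsIrreducible.representsProduction (hN : N.IsIrreducible) :
    N.RepresentsProduction N.productionMatrix := fun k hk q hq => by
  let linear : N.natKernel →+ (Σ v, A v) → ℚ := N.productionMatrix.mulVecLin.toAddMonoidHom.comp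
    (((Nat.castAddMonoidHom ℚ).compLeft (Σ v, A v)).comp N.natKernel.subtype)
  have hprod : production hq = linear := by
    refine addMonoidHom_eq_of_single_mem (fun a => (N.resetNumber_spec a).1.ne')
      (fun a => (N.resetNumber_spec a).2) fun a => ?_
    rw [← hN.productionMatrix_mulVec_single hq]
    exact congrArg (N.productionMatrix *ᵥ ·) (natCast_single a _).symm
  exact ⟨fun b => congrFun (DFunLike.congr_fun hprod ⟨k, hk⟩) b, localAct_snd_eq_self hk hq⟩

end Production

section Discrepancy

variable [Fintype V] [∀ v, Fintype (A v)] {P : Matrix (Σ v, A v) (Σ v, A v) ℚ}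

variable (N) in
/-- The difference between the numbers of letters sent out when exactly the letters `x` are
processed and the numbers `P x` predicted by a matrix `P`. -/
noncomputable def discrepancy (P : Matrix (Σ v, A v) (Σ v, A v) ℚ) (x : (Σ v, A v) → ℕ)
    (q : ∀ v, Q v) : (Σ v, A v) → ℚ :=
  fun b => ((N.localAct x q).1 b : ℚ) - (P *ᵥ fun a => (x a : ℚ)) b

theorem discrepancy_add (x y : (Σ v, A v) → ℕ) (q : ∀ v, Q v) :
    N.discrepancy P (x + y) q
      = N.discrepancy P x q + N.discrepancy P y (N.localAct x q).2 := by
  have hcast : (fun a => ((x + y) a : ℚ)) = (fun a => (x a : ℚ)) + fun a => (y a : ℚ) :=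
    funext fun a => Nat.cast_add _ _
  ext b
  rw [Pi.add_apply]
  simp only [discrepancy, hcast, mulVec_add, localAct_add]
  simp only [Pi.add_apply, Int.cast_add]
  ring

theorem RepresentsProduction.discrepancy_add_left (hP : N.RepresentsProduction P)
    {k : (Σ v, A v) → ℕ} (hk : k ∈ N.natKernel) {q : ∀ v, Q v} (hq : N.IsLocallyRecurrent q)
    (x : (Σ v, A v) → ℕ) : N.discrepancy P (k + x) q = N.discrepancy P x q := by
  have hzero : N.discrepancy P k q = 0 := funext fun b => sub_eq_zero.2 ((hP k hk q hq).1 b)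
  rw [discrepancy_add, hzero, localAct_snd_eq_self hk hq, zero_add]

theorem IsCompleteLegal.one_sub_mulVec_count {w : List (Σ v, A v)} {x : (Σ v, A v) → ℕ}
    {q : ∀ v, Q v} (h : N.IsCompleteLegal w x q) (P : Matrix (Σ v, A v) (Σ v, A v) ℚ) :
    (1 - P) *ᵥ (fun a => (w.count a : ℚ))
      = (fun a => (x a : ℚ)) + N.discrepancy P (fun a => w.count a) q := by
  have hfinal : (N.exec w (input x q)).1 = 0 :=
    le_antisymm h.2 (h.1.exec_nonneg fun a => Nat.cast_nonneg _)
  ext b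
  have hb : (x b : ℚ) - w.count b + (N.localAct (fun a => w.count a) q).1 b = 0 := by
    rw [exec_eq_localAct] at hfinal
    simpa [input] using congrArg (Int.cast : ℤ → ℚ) (congrFun hfinal b)
  simp only [sub_mulVec, one_mulVec, Pi.sub_apply, Pi.add_apply, discrepancy]
  linarith

variable [∀ v, Finite (Q v)]

/-- Reducing `x` modulo the resets `r_a 1_a` leaves finitely many inputs. -/
theorem RepresentsProduction.exists_norm_discrepancy_le_of_isLocallyRecurrent
    (hP : N.RepresentsProduction P) :
    ∃ C : ℝ, ∀ x q, N.IsLocallyRecurrent q → ‖N.discrepancy P x q‖ ≤ C := by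
  obtain ⟨C, hC⟩ := Finite.exists_le fun i : Set.Iic N.resetNumber × (∀ v, Q v) =>
    ‖N.discrepancy P i.1 i.2‖
  refine ⟨C, fun x q hq => ?_⟩
  have hx : N.resetNumber * (fun a => x a / N.resetNumber a)
      + (fun a => x a % N.resetNumber a) = x :=
    funext fun a => Nat.div_add_mod (x a) (N.resetNumber a)
  rw [← hx, hP.discrepancy_add_left
    (mul_mem_of_single_mem (fun a => (N.resetNumber_spec a).2) _) hq]
  exact hC (⟨_, fun a => (Nat.mod_lt _ (N.resetNumber_spec a).1).le⟩, q)

/-- Processing a fixed input `z` first makes the state locally recurrent; doing so before or after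
`x` changes the discrepancy by a bounded amount. -/
theorem RepresentsProduction.exists_norm_discrepancy_le (hP : N.RepresentsProduction P) :
    ∃ C : ℝ, ∀ x q, ‖N.discrepancy P x q‖ ≤ C := by
  obtain ⟨z, hz⟩ := N.exists_forall_isLocallyRecurrent_localAct
  obtain ⟨C, hC⟩ := hP.exists_norm_discrepancy_le_of_isLocallyRecurrent
  obtain ⟨D, hD⟩ := Finite.exists_le fun q => ‖N.discrepancy P z q‖
  refine ⟨D + C + D, fun x q => ?_⟩
  have hxz : N.discrepancy P x q = N.discrepancy P z q + N.discrepancy P x (N.localAct z q).2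
      - N.discrepancy P z (N.localAct x q).2 := by
    rw [← discrepancy_add, add_comm z x, discrepancy_add, add_sub_cancel_right]
  rw [hxz]
  exact norm_sub_le_of_le (norm_add_le_of_le (hD q) (hC x _ (hz q))) (hD _)

theorem RepresentsProduction.isUnit_one_sub (hP : N.RepresentsProduction P)
    (hhalt : N.HaltsOnAllInputs) (q : ∀ v, Q v) : IsUnit (1 - P) := by
  have : NormSMulClass ℤ ℚ :=
    ⟨fun n x => by rw [zsmul_eq_mul, norm_mul, Int.norm_cast_rat]⟩
  obtain ⟨C, hC⟩ := hP.exists_norm_discrepancy_le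
  refine isUnit_of_forall_exists_norm_mulVec_sub_le (C := C) fun x => ?_
  obtain ⟨w, hw⟩ := hhalt x q
  refine ⟨fun a => (w.count a : ℚ), ?_⟩
  rw [hw.one_sub_mulVec_count, add_sub_cancel_left]
  exact hC _ q

open scoped Matrix.Norms.Operator in
theorem RepresentsProduction.exists_norm_count_sub_le (hP : N.RepresentsProduction P)
    (hunit : IsUnit (1 - P)) :
    ∃ C : ℝ, ∀ (x : (Σ v, A v) → ℕ) (q : ∀ v, Q v) (w : List (Σ v, A v)),
      N.IsCompleteLegal w x q →
      ‖(fun a => (w.count a : ℚ)) - (1 - P)⁻¹ *ᵥ (fun a => (x a : ℚ))‖ ≤ C := by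
  obtain ⟨C, hC⟩ := hP.exists_norm_discrepancy_le
  refine ⟨‖(1 - P)⁻¹‖ * C, fun x q w hw => ?_⟩
  have hcount : (fun a => (w.count a : ℚ)) = (1 - P)⁻¹ *ᵥ ((fun a => (x a : ℚ))
      + N.discrepancy P (fun a => w.count a) q) := by
    rw [← hw.one_sub_mulVec_count, mulVec_mulVec,
      nonsing_inv_mul _ ((isUnit_iff_isUnit_det _).1 hunit), one_mulVec]
  rw [hcount, mulVec_add, add_sub_cancel_left]
  exact (linfty_opNorm_mulVec _ _).trans (mul_le_mul_of_nonneg_left (hC _ q) (norm_nonneg _))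

end Discrepancy

theorem IsIrreducible.isUnit_one_sub_productionMatrix [Fintype V] [∀ v, Fintype (A v)]
    [∀ v, Finite (Q v)] (hN : N.IsIrreducible) (hhalt : N.HaltsOnAllInputs) :
    IsUnit (1 - N.productionMatrix) := by
  obtain hQ | ⟨⟨q⟩⟩ := isEmpty_or_nonempty (∀ v, Q v)
  · rw [productionMatrix, dif_neg fun ⟨q, _⟩ => hQ.false q, sub_zero]
    exact isUnit_one
  · exact hN.representsProduction.isUnit_one_sub hhalt q

end AbelianNetwork

theorem theorem4p2 {V : Type*} [Fintype V] [DecidableEq V] {G : Digraph V} {A Q : V → Type*}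
    [∀ v, Fintype (A v)] [∀ v, DecidableEq (A v)] [∀ v, Finite (Q v)]
    (N : AbelianNetwork G A Q) (hirr : N.IsIrreducible) (hhalt : N.HaltsOnAllInputs) :
    N.RepresentsProduction N.productionMatrix ∧
    IsUnit (1 - N.productionMatrix) ∧
    (∃ C : ℝ, ∀ (x : (Σ v, A v) → ℕ) (q : ∀ v, Q v),
      ‖(fun a => (N.odometer x q a : ℚ)) -
        (1 - N.productionMatrix)⁻¹ *ᵥ (fun a => (x a : ℚ))‖ ≤ C) ∧
    (∃ C' : ℚ, ∀ (x : (Σ v, A v) → ℕ) (q : ∀ v, Q v) (w : List (Σ v, A v)),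
      N.IsCompleteLegal w x q →
      |(w.length : ℚ) -
        ∑ a, ((1 - N.productionMatrix)⁻¹ *ᵥ (fun a => (x a : ℚ))) a| ≤ C') := by
  have hP := hirr.representsProduction
  have hunit := hirr.isUnit_one_sub_productionMatrix hhalt
  obtain ⟨C, hC⟩ := hP.exists_norm_count_sub_le hunit
  obtain ⟨C', hC'⟩ := exists_rat_gt (Fintype.card (Σ v, A v) • C)
  refine ⟨hP, hunit, ⟨C, fun x q => ?_⟩, ⟨C', fun x q w hw => ?_⟩⟩
  · obtain ⟨w, hw⟩ := hhalt x q
    simpa only [N.odometer_eq hw] using hC x q w hw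
  · have h := (norm_length_sub_sum_le w _).trans (nsmul_le_nsmul_right (hC x q w hw) _)
    rw [← Rat.norm_cast_real, Real.norm_eq_abs] at h
    exact_mod_cast h.trans hC'.le
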